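/- For a positive integer $m$ let $\Phi_m(q)$ be the $m$-th cyclotomic polynomial, let $[m]_q=1+q+\cdots+q^{m-1}$ (so that $[m]_{q^2}=1+q^2+\cdots+q^{2(m-1)}$), and let $(a;q)_0=1$ and $(a;q)_k=(1-a)(1-aq)\cdots(1-aq^{k-1})$ for $k\geqslant 1$. For rational functions $A(q),B(q)\in\mathbb{Q}(q)$ and a polynomial $P(q)\in\mathbb{Q}[q]$, write $A(q)\equiv B(q)\pmod{P(q)}$ if $P(q)$ divides the numerator of $A(q)-B(q)$ written in lowest terms. Theorem. Let $n$ and $r$ be positive integers with $n\equiv 3\pmod 4$. Then, modulo $\Phi_{n^{2r}}(q)^2\prod_{j=1}^{r}\Phi_{n^{2j-1}}(q)^2$, we have $$\sum_{k=0}^{(n^{2r}-1)/2}\frac{(1+q^{4k+1})(q^2;q^4)_k^3}{(1+q)(q^4;q^4)_k^3}\,q^k\equiv \frac{[n^{2r}]_{q^2}\,(q^3;q^4)_{(n^{2r}-1)/2}}{(q^5;q^4)_{(n^{2r}-1)/2}}\,q^{(1-n^{2r})/2}$$ and $$\sum_{k=0}^{n^{2r}-1}\frac{(1+q^{4k+1})(q^2;q^4)_k^3}{(1+q)(q^4;q^4)_k^3}\,q^k\equiv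 \frac{[n^{2r}]_{q^2}\,(q^3;q^4)_{(n^{2r}-1)/2}}{(q^5;q^4)_{(n^{2r}-1)/2}}\,q^{(1-n^{2r})/2}.$$ -/

import Mathlib

open Polynomial

/-- The `q`-shifted factorial `(a;q)_k = (1 - a)(1 - a q) ⋯ (1 - a q ^ (k - 1))`. -/
def qShiftedFactorial {R : Type*} [CommRing R] (a q : R) (k : ℕ) : R :=
  ∏ i ∈ Finset.range k, (1 - a * q ^ i)

/-- The `q`-integer `[k]_q = 1 + q + ⋯ + q ^ (k - 1)`. -/
def qInteger {R : Type*} [CommRing R] (q : R) (k : ℕ) : R :=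
  ∑ i ∈ Finset.range k, q ^ i

/-- Congruence of two rational functions modulo a polynomial `P`: the polynomial `P` divides the
numerator of their difference, written in lowest terms. -/
def RatCongr (P : ℚ[X]) (A B : RatFunc ℚ) : Prop :=
  P ∣ (A - B).num

/-- The truncated sum
`∑_{k=0}^{M} (1 + q^{4k+1}) (q^2;q^4)_k^3 / ((1 + q) (q^4;q^4)_k^3) * q^k`. -/
noncomputable def truncatedSum {K : Type*} [Field K] (q : K) (M : ℕ) : K :=
  ∑ k ∈ Finset.range (M + 1),
    (1 + q ^ (4 * k + 1)) * qShiftedFactorial (q ^ 2) (q ^ 4) k ^ 3 /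
      ((1 + q) * qShiftedFactorial (q ^ 4) (q ^ 4) k ^ 3) * q ^ k

/-- The rational function
`[N]_{q^2} (q^3;q^4)_{(N-1)/2} / (q^5;q^4)_{(N-1)/2} * q^{(1-N)/2}`, for odd `N`. -/
noncomputable def closedForm {K : Type*} [Field K] (q : K) (N : ℕ) : K :=
  qInteger (q ^ 2) N * qShiftedFactorial (q ^ 3) (q ^ 4) ((N - 1) / 2) /
    qShiftedFactorial (q ^ 5) (q ^ 4) ((N - 1) / 2) * q ^ ((1 - (N : ℤ)) / 2)

/-! ### Terminating very-well-poised summation. -/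

section BasicHypergeometric

variable {K : Type*} [Field K]

/-! Let `N = d * (2 * s + 1)` with `d` odd, and work modulo `Φ_d(q)^2`. In two of the three shifted
factorials, above and below, replace each `(1 - q^e)^2` by `(1 - q^(e-2N)) * (1 - q^(e+2N))`. The
series becomes a terminating `₆φ₅` whose sum is exactly `closedForm q N` (`sum_deformedTerm`). The
replacement subtracts `q^(e-2N) * (1 - q^(2N))^2`, which is negligible unless `d ∣ e`. To control
those exceptional `e`, cut the series into blocks of `d` terms. The second half of each block is
divisible by `Φ_d(q)^3`; in the first half the current block contributes no exceptional `e`, and the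
earlier blocks contribute a common unit `blockFactor`. Hence `∑ blockFactor * blockSum ≡ closedForm`
(`map_sum_blockFactor_mul_blockSum_sub_le`). For `d = n^(2r)` take `s = 0`: there is one block, with
factor `1`, and the congruence is immediate. For `d = n^(2j-1)`, where `d ≡ 3 (mod 4)`, the closed
form is itself divisible by `Φ_d(q)^2`; induction on the number of blocks shows that each block sum
is too (`map_blockSum_le`), so both sides vanish. -/

theorem qShiftedFactorial_zero (a q : K) : qShiftedFactorial a q 0 = 1 := by
  simp [qShiftedFactorial]

theorem qShiftedFactorial_succ (a q : K) (k : ℕ) :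
    qShiftedFactorial a q (k + 1) = qShiftedFactorial a q k * (1 - a * q ^ k) :=
  Finset.prod_range_succ _ _

theorem qShiftedFactorial_succ' (a q : K) (k : ℕ) :
    qShiftedFactorial a q (k + 1) = (1 - a) * qShiftedFactorial (a * q) q k := by
  simp only [qShiftedFactorial, Finset.prod_range_succ']
  rw [mul_comm]
  simp [pow_succ', mul_assoc]

theorem qShiftedFactorial_ne_zero {a q : K} {k : ℕ} (h : ∀ i, 1 - a * q ^ i ≠ 0) :
    qShiftedFactorial a q k ≠ 0 :=
  Finset.prod_ne_zero_iff.mpr fun i _ => h i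

/-- The summand of the very-well-poised series `₆φ₅` with base `p`, whose terminating parameter
is `1 / x`. -/
def veryWellPoisedTerm (A b d p x : K) (k : ℕ) : K :=
  (1 - A * p ^ (2 * k)) / (1 - A) *
    (qShiftedFactorial A p k * qShiftedFactorial b p k * qShiftedFactorial d p k *
      qShiftedFactorial (1 / x) p k) /
    (qShiftedFactorial p p k * qShiftedFactorial (A * p / b) p k *
      qShiftedFactorial (A * p / d) p k * qShiftedFactorial (A * p * x) p k) *
    (A * p * x / (b * d)) ^ k

/-- A telescoping certificate for the contiguous relation between `x` and `p * x`. Once its right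
side vanishes, it is a first-order recurrence for the sums. -/
theorem veryWellPoisedTerm_telescope {A b d p x : K} (hA : 1 - A ≠ 0) (hb : b ≠ 0) (hd : d ≠ 0)
    (hp : p ≠ 0) (hx : x ≠ 0) (h₁ : ∀ i : ℕ, 1 - p * p ^ i ≠ 0)
    (h₂ : ∀ i : ℕ, 1 - A * p / b * p ^ i ≠ 0) (h₃ : ∀ i : ℕ, 1 - A * p / d * p ^ i ≠ 0)
    (h₄ : ∀ i : ℕ, 1 - A * p * x * p ^ i ≠ 0) (k : ℕ) :
    ∑ i ∈ Finset.range (k + 1),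
      ((1 - A * p * x / b) * (1 - A * p * x / d) * veryWellPoisedTerm A b d p (p * x) i -
        (1 - A * p * x) * (1 - A * p * x / (b * d)) * veryWellPoisedTerm A b d p x i) =
    A * p * x * (1 - 1 / b) * (1 - 1 / d) *
      (qShiftedFactorial (A * p) p k * qShiftedFactorial (b * p) p k *
        qShiftedFactorial (d * p) p k * qShiftedFactorial (1 / x) p k) /
      (qShiftedFactorial p p k * qShiftedFactorial (A * p / b) p k *
        qShiftedFactorial (A * p / d) p k * qShiftedFactorial (A * p * x * p) p k) *
      (A * p * x / (b * d)) ^ k := by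
  have h₅ : ∀ i : ℕ, 1 - A * p * x * p * p ^ i ≠ 0 := fun i => by
    have := h₄ (i + 1)
    rwa [pow_succ', ← mul_assoc] at this
  induction k with
  | zero =>
    simp only [zero_add, Finset.range_one, Finset.sum_singleton, veryWellPoisedTerm,
      qShiftedFactorial_zero, mul_zero, pow_zero, mul_one, div_one, div_self hA]
    field_simp
    ring
  | succ k ih =>
    rw [Finset.sum_range_succ, ih]
    have e₁ : qShiftedFactorial (1 / (p * x)) p (k + 1) =
        (1 - 1 / (p * x)) * qShiftedFactorial (1 / x) p k := by
      rw [qShiftedFactorial_succ']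
      congr 2
      field_simp
    have e₂ : A * p * (p * x) = A * p * x * p := by ring
    have e₃ : (A * p * x * p / (b * d)) ^ (k + 1) =
        (A * p * x / (b * d)) ^ k * (A * p * x / (b * d)) * (p ^ k * p) := by
      rw [← pow_succ, ← pow_succ, ← mul_pow]
      ring
    have n₁ := qShiftedFactorial_ne_zero (k := k) h₁
    have n₂ := qShiftedFactorial_ne_zero (k := k) h₂
    have n₃ := qShiftedFactorial_ne_zero (k := k) h₃
    have n₅ := qShiftedFactorial_ne_zero (k := k) h₅
    simp only [veryWellPoisedTerm, e₁, e₂, e₃]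
    rw [qShiftedFactorial_succ' A, qShiftedFactorial_succ' b, qShiftedFactorial_succ' d,
      qShiftedFactorial_succ' (A * p * x), qShiftedFactorial_succ p,
      qShiftedFactorial_succ (A * p / b), qShiftedFactorial_succ (A * p / d),
      qShiftedFactorial_succ (A * p * x * p), qShiftedFactorial_succ (1 / x),
      qShiftedFactorial_succ (A * p), qShiftedFactorial_succ (b * p),
      qShiftedFactorial_succ (d * p), pow_succ (A * p * x / (b * d)),
      show p ^ (2 * (k + 1)) = (p ^ k * p) ^ 2 by ring]
    have m₁ := h₁ k
    have m₂ := h₂ k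
    have m₃ := h₃ k
    have m₄ : 1 - A * p * x ≠ 0 := by simpa using h₄ 0
    have m₅ := h₅ k
    generalize qShiftedFactorial p p k = c₁ at *
    generalize qShiftedFactorial (A * p / b) p k = c₂ at *
    generalize qShiftedFactorial (A * p / d) p k = c₃ at *
    generalize qShiftedFactorial (A * p * x * p) p k = c₅ at *
    generalize qShiftedFactorial (A * p) p k = a₁ at *
    generalize qShiftedFactorial (b * p) p k = a₂ at *
    generalize qShiftedFactorial (d * p) p k = a₃ at *
    generalize qShiftedFactorial (1 / x) p k = a₄ at *
    generalize (A * p * x / (b * d)) ^ k = z at *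
    generalize p ^ k = y at *
    -- With `y = p^k`, this is what remains after removing common products: the new summand equals
    -- the difference of consecutive certificates.
    have key : (1 - A * (y * p) ^ 2) * ((1 - A * p * x / b) * (1 - A * p * x / d) *
          (1 - 1 / (p * x)) * (y * p) -
          (1 - A * p * x / (b * d)) * (1 - 1 / x * y) * (1 - A * p * x * p * y)) =
        (1 - A * p * y) * (1 - b * p * y) * (1 - d * p * y) * (1 - 1 / x * y) *
          (A * p * x / (b * d)) -
        (1 - p * y) * (1 - A * p / b * y) * (1 - A * p / d * y) * (1 - A * p * x * p * y) := by
      field_simp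
      ring
    have hz : A * p * x * (1 - 1 / b) * (1 - 1 / d) =
        A * p * x / (b * d) * ((1 - b) * (1 - d)) := by
      field_simp
      ring
    rw [hz]
    generalize A * p * x / (b * d) = w at *
    generalize hα : (1 - A * p * x / b) * (1 - A * p * x / d) = α at *
    generalize 1 - 1 / (p * x) = s at *
    generalize 1 - 1 / x * y = t at *
    generalize 1 - A * p * x * p * y = D₅ at *
    generalize 1 - A * p * x = D₄ at *
    generalize 1 - p * y = D₁ at *
    generalize 1 - A * p / b * y = D₂ at *
    generalize 1 - A * p / d * y = D₃ at *
    field_simp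
    linear_combination w * z * (1 - b) * (1 - d) * a₁ * a₂ * a₃ * a₄ * key

/-- The terminating very-well-poised `₆φ₅` summation. -/
theorem sum_veryWellPoisedTerm {A b d p : K} (hA : 1 - A ≠ 0) (hb : b ≠ 0) (hd : d ≠ 0)
    (hp : p ≠ 0) (h₁ : ∀ i : ℕ, 1 - p * p ^ i ≠ 0)
    (h₂ : ∀ i : ℕ, 1 - A * p / b * p ^ i ≠ 0) (h₃ : ∀ i : ℕ, 1 - A * p / d * p ^ i ≠ 0)
    (h₄ : ∀ i : ℕ, 1 - A * p * p ^ i ≠ 0) (m : ℕ) :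
    (∑ i ∈ Finset.range (m + 1), veryWellPoisedTerm A b d p (p ^ m) i) *
      (qShiftedFactorial (A * p / b) p m * qShiftedFactorial (A * p / d) p m) =
    qShiftedFactorial (A * p) p m * qShiftedFactorial (A * p / (b * d)) p m := by
  induction m with
  | zero => simp [veryWellPoisedTerm, qShiftedFactorial_zero, div_self hA]
  | succ m ih =>
    have h := veryWellPoisedTerm_telescope hA hb hd hp (pow_ne_zero m hp) h₁ h₂ h₃
      (fun i => by rw [mul_assoc, ← pow_add]; exact h₄ _) (m + 1)
    -- This zero kills both the certificate and the extra term of the sum at `x = p^m`.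
    have hz : qShiftedFactorial (1 / p ^ m) p (m + 1) = 0 := by
      rw [qShiftedFactorial_succ, one_div_mul_cancel (pow_ne_zero m hp), sub_self, mul_zero]
    rw [hz, mul_zero, mul_zero, zero_div, zero_mul, Finset.sum_sub_distrib, ← Finset.mul_sum,
      ← Finset.mul_sum, Finset.sum_range_succ (veryWellPoisedTerm A b d p (p ^ m)),
      show veryWellPoisedTerm A b d p (p ^ m) (m + 1) = 0 by rw [veryWellPoisedTerm, hz]; simp,
      add_zero, ← pow_succ'] at h
    rw [qShiftedFactorial_succ, qShiftedFactorial_succ, qShiftedFactorial_succ,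
      qShiftedFactorial_succ]
    linear_combination qShiftedFactorial (A * p / b) p m * qShiftedFactorial (A * p / d) p m * h +
      (1 - A * p * p ^ m) * (1 - A * p * p ^ m / (b * d)) * ih

end BasicHypergeometric

/-! ### The deformed series and its closed form. -/

section DeformedSeries

variable {K : Type*} [Field K]

/-- The summand of `truncatedSum`. -/
def seriesTerm (q : K) (k : ℕ) : K :=
  (1 + q ^ (4 * k + 1)) * qShiftedFactorial (q ^ 2) (q ^ 4) k ^ 3 /
    ((1 + q) * qShiftedFactorial (q ^ 4) (q ^ 4) k ^ 3) * q ^ k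

theorem truncatedSum_eq_sum (q : K) (M : ℕ) :
    truncatedSum q M = ∑ k ∈ Finset.range (M + 1), seriesTerm q k := rfl

/-- The factor by which `(1 - q ^ e) ^ 2` changes when it is deformed to
`(1 - q ^ (e - 2 * N)) * (1 - q ^ (e + 2 * N))`. -/
def deformationFactor (q : K) (N e : ℤ) : K :=
  (1 - q ^ (e - 2 * N)) * (1 - q ^ (e + 2 * N)) / (1 - q ^ e) ^ 2

/-- The summand of the series obtained from `truncatedSum` by deforming two of the three shifted
factorials in the numerator and in the denominator. -/
def deformedTerm (q : K) (N : ℤ) (k : ℕ) : K :=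
  seriesTerm q k * ∏ i ∈ Finset.range k,
    deformationFactor q N (4 * i + 2) / deformationFactor q N (4 * i + 4)

theorem qShiftedFactorial_zpow {q : K} (hq : q ≠ 0) (a : ℤ) (k : ℕ) :
    qShiftedFactorial (q ^ a) (q ^ 4) k = ∏ i ∈ Finset.range k, (1 - q ^ (4 * (i : ℤ) + a)) := by
  refine Finset.prod_congr rfl fun i _ => ?_
  rw [add_comm, zpow_add₀ hq, zpow_mul, zpow_natCast]
  norm_cast

theorem prod_deformationFactor {q : K} (hq : q ≠ 0) (N e : ℤ) (k : ℕ) :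
    ∏ i ∈ Finset.range k, deformationFactor q N (4 * i + e) =
      qShiftedFactorial (q ^ (e - 2 * N)) (q ^ 4) k *
        qShiftedFactorial (q ^ (e + 2 * N)) (q ^ 4) k / qShiftedFactorial (q ^ e) (q ^ 4) k ^ 2 := by
  simp only [deformationFactor, qShiftedFactorial_zpow hq, Finset.prod_div_distrib,
    Finset.prod_mul_distrib, Finset.prod_pow, add_sub_assoc, add_assoc]

theorem one_sub_zpow_ne_zero {q : K} (h : ∀ e : ℤ, e ≠ 0 → q ^ e ≠ 1) {e : ℤ} (he : e ≠ 0) :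
    1 - q ^ e ≠ 0 :=
  sub_ne_zero.mpr (h e he).symm

/-- With `N = 2m+1`, the parameters `d = q^(2+2N)` and `1/x = q^(2-2N)` are the deformed pair. The
choice `b = q` reduces the very-well-poised factor to `(1 + q^(4k+1)) / (1 + q)` and the argument to
`q`. -/
theorem deformedTerm_eq_veryWellPoisedTerm {q : K} (hq : q ≠ 0)
    (h : ∀ e : ℤ, e ≠ 0 → q ^ e ≠ 1) (m k : ℕ) :
    deformedTerm q (2 * m + 1) k =
      veryWellPoisedTerm (q ^ 2) q (q ^ (4 * m + 4)) (q ^ 4) ((q ^ 4) ^ m) k := by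
  have hne : ∀ a : ℤ, (∀ i : ℕ, 4 * (i : ℤ) + a ≠ 0) →
      qShiftedFactorial (q ^ a) (q ^ 4) k ≠ 0 := fun a ha => by
    rw [qShiftedFactorial_zpow hq]
    exact Finset.prod_ne_zero_iff.mpr fun i _ => one_sub_zpow_ne_zero h (ha i)
  have z₁ : q ^ 2 = q ^ (2 : ℤ) := by norm_cast
  have z₂ : 1 / (q ^ 4) ^ m = q ^ ((2 : ℤ) - 2 * (2 * m + 1)) := by
    rw [one_div, ← pow_mul, ← zpow_natCast, ← zpow_neg]
    congr 1; push_cast; ring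
  have z₃ : q ^ (4 * m + 4) = q ^ ((2 : ℤ) + 2 * (2 * m + 1)) := by
    rw [← zpow_natCast]
    congr 1; push_cast; ring
  have z₄ : q ^ 2 * q ^ 4 / q = q ^ (5 : ℤ) := by
    norm_cast; field_simp
  have z₅ : q ^ 2 * q ^ 4 / q ^ (4 * m + 4) = q ^ ((4 : ℤ) - 2 * (2 * m + 1)) := by
    rw [← pow_add, ← zpow_natCast, ← zpow_natCast, ← zpow_sub₀ hq]
    congr 1; push_cast; ring
  have z₆ : q ^ 2 * q ^ 4 * (q ^ 4) ^ m = q ^ ((4 : ℤ) + 2 * (2 * m + 1)) := by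
    rw [← pow_add, ← pow_mul, ← pow_add, ← zpow_natCast]
    congr 1; push_cast; ring
  have z₇ : q ^ 2 * q ^ 4 * (q ^ 4) ^ m / (q * q ^ (4 * m + 4)) = q := by
    rw [div_eq_iff (by positivity)]
    ring
  have hC : (1 - q) * qShiftedFactorial (q ^ 5) (q ^ 4) k =
      qShiftedFactorial q (q ^ 4) k * (1 - q ^ (4 * k + 1)) := by
    have := qShiftedFactorial_succ' q (q ^ 4) k
    rw [qShiftedFactorial_succ] at this
    rw [show q ^ 5 = q * q ^ 4 by ring, ← this, show q ^ (4 * k + 1) = q * (q ^ 4) ^ k by ring]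
  have n₁ : 1 - q ≠ 0 := by simpa using one_sub_zpow_ne_zero h one_ne_zero
  have n₂ : 1 - q ^ 2 ≠ 0 := by exact_mod_cast one_sub_zpow_ne_zero h two_ne_zero
  have n₂' : 1 + q ≠ 0 := fun h0 => n₂ (by linear_combination (1 - q) * h0)
  have n₃ : 1 - q ^ (4 * k + 1) ≠ 0 := by
    exact_mod_cast one_sub_zpow_ne_zero h (e := ((4 * k + 1 : ℕ) : ℤ)) (by omega)
  have n₄ : qShiftedFactorial (q ^ 4) (q ^ 4) k ≠ 0 := by
    exact_mod_cast hne 4 (fun i => by omega)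
  have n₅ : qShiftedFactorial (q ^ (5 : ℤ)) (q ^ 4) k ≠ 0 := hne 5 (fun i => by omega)
  have n₆ := hne 2 (fun i => by omega)
  have n₇ := hne (4 - 2 * (2 * m + 1)) (fun i => by omega)
  have n₈ := hne (4 + 2 * (2 * m + 1)) (fun i => by omega)
  have z₈ : q ^ (5 : ℤ) = q ^ 5 := by norm_cast
  have z₉ : q ^ (4 : ℤ) = q ^ 4 := by norm_cast
  rw [deformedTerm, Finset.prod_div_distrib, prod_deformationFactor hq, prod_deformationFactor hq,
    seriesTerm, veryWellPoisedTerm, z₇, z₂, z₄, z₅, z₆, z₃, z₁, z₉, ← z₁]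
  rw [← z₈] at hC
  rw [show (q ^ 4) ^ (2 * k) = (q ^ (4 * k)) ^ 2 by ring]
  rw [show q ^ (4 * k + 1) = q ^ (4 * k) * q from pow_succ _ _] at hC n₃ ⊢
  rw [← z₁] at n₆
  generalize qShiftedFactorial (q ^ (5 : ℤ)) (q ^ 4) k = c₁ at *
  generalize qShiftedFactorial (q ^ ((4 : ℤ) - 2 * (2 * m + 1))) (q ^ 4) k = c₂ at *
  generalize qShiftedFactorial (q ^ ((4 : ℤ) + 2 * (2 * m + 1))) (q ^ 4) k = c₃ at *
  generalize qShiftedFactorial (q ^ ((2 : ℤ) - 2 * (2 * m + 1))) (q ^ 4) k = c₄ at *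
  generalize qShiftedFactorial (q ^ ((2 : ℤ) + 2 * (2 * m + 1))) (q ^ 4) k = c₅ at *
  generalize qShiftedFactorial (q ^ 2) (q ^ 4) k = c₆ at *
  generalize qShiftedFactorial (q ^ 4) (q ^ 4) k = c₇ at *
  generalize qShiftedFactorial q (q ^ 4) k = c₈ at *
  generalize q ^ (4 * k) = y at *
  generalize q ^ k = z at *
  have hfac : (1 - q ^ 2 * y ^ 2) / (1 - q ^ 2) * c₈ = (1 + y * q) / (1 + q) * c₁ := by
    field_simp
    linear_combination -(1 + y * q) * (1 + q) * hC
  have hsplit : (1 - q ^ 2 * y ^ 2) / (1 - q ^ 2) * (c₆ * c₈ * c₅ * c₄) / (c₇ * c₁ * c₂ * c₃) * z =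
      ((1 - q ^ 2 * y ^ 2) / (1 - q ^ 2) * c₈) * (c₆ * c₅ * c₄) / (c₇ * c₁ * c₂ * c₃) * z := by
    ring
  rw [hsplit, hfac]
  field_simp

theorem qInteger_mul_one_sub (q : K) (k : ℕ) : qInteger q k * (1 - q) = 1 - q ^ k := by
  rw [qInteger, ← neg_sub q 1, mul_neg, geom_sum_mul, neg_sub]

/-- Reverse the products with negative exponents and use `1 - q^(-a) = -q^(-a) * (1 - q^a)`; each
index leaves one factor `q⁻¹`. -/
theorem prod_one_sub_zpow_reflect {q : K} (hq : q ≠ 0) (m : ℕ) :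
    qShiftedFactorial (q ^ (1 - 4 * m : ℤ)) (q ^ 4) m * qShiftedFactorial (q ^ (2 : ℤ)) (q ^ 4) m =
      q ^ (-m : ℤ) * qShiftedFactorial (q ^ (2 - 4 * m : ℤ)) (q ^ 4) m *
        qShiftedFactorial (q ^ (3 : ℤ)) (q ^ 4) m := by
  have reflect : ∀ a : ℤ, qShiftedFactorial (q ^ (a - 4 * m : ℤ)) (q ^ 4) m =
      ∏ i ∈ Finset.range m, (1 - q ^ (a - 4 - 4 * (i : ℤ))) := fun a => by
    rw [qShiftedFactorial_zpow hq, ← Finset.prod_range_reflect]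
    refine Finset.prod_congr rfl fun i hi => ?_
    have := Finset.mem_range.mp hi
    congr 2
    omega
  rw [reflect, reflect, qShiftedFactorial_zpow hq, qShiftedFactorial_zpow hq,
    show q ^ (-m : ℤ) = ∏ i ∈ Finset.range m, q⁻¹ by simp, ← Finset.prod_mul_distrib,
    ← Finset.prod_mul_distrib, ← Finset.prod_mul_distrib]
  refine Finset.prod_congr rfl fun i _ => ?_
  have e₁ : q ^ (1 - 4 - 4 * (i : ℤ)) = (q ^ 3 * q ^ (4 * (i : ℤ)))⁻¹ := by
    rw [show (1 - 4 - 4 * (i : ℤ)) = -(3 + 4 * (i : ℤ)) by ring, zpow_neg, zpow_add₀ hq]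
    norm_cast
  have e₂ : q ^ (2 - 4 - 4 * (i : ℤ)) = (q ^ 2 * q ^ (4 * (i : ℤ)))⁻¹ := by
    rw [show (2 - 4 - 4 * (i : ℤ)) = -(2 + 4 * (i : ℤ)) by ring, zpow_neg, zpow_add₀ hq]
    norm_cast
  have e₃ : q ^ (4 * (i : ℤ) + 2) = q ^ 2 * q ^ (4 * (i : ℤ)) := by
    rw [add_comm, zpow_add₀ hq]
    norm_cast
  have e₄ : q ^ (4 * (i : ℤ) + 3) = q ^ 3 * q ^ (4 * (i : ℤ)) := by
    rw [add_comm, zpow_add₀ hq]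
    norm_cast
  have hy : q ^ (4 * (i : ℤ)) ≠ 0 := zpow_ne_zero _ hq
  rw [e₁, e₂, e₃, e₄]
  generalize q ^ (4 * (i : ℤ)) = y at *
  field_simp
  ring

theorem sum_deformedTerm {q : K} (hq : q ≠ 0) (h : ∀ e : ℤ, e ≠ 0 → q ^ e ≠ 1) (m : ℕ) :
    ∑ k ∈ Finset.range (m + 1), deformedTerm q (2 * m + 1) k = closedForm q (2 * m + 1) := by
  have hE : ∀ e : ℤ, e ≠ 0 → 1 - q ^ e ≠ 0 := fun e => one_sub_zpow_ne_zero h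
  have z₁ : q ^ 2 * q ^ 4 = q ^ (6 : ℤ) := by norm_cast; ring
  have z₂ : q ^ (6 : ℤ) / q = q ^ (5 : ℤ) := by
    norm_cast; field_simp
  have z₃ : q ^ (6 : ℤ) / q ^ (4 * m + 4) = q ^ (2 - 4 * m : ℤ) := by
    rw [← zpow_natCast, ← zpow_sub₀ hq]
    congr 1; push_cast; ring
  have z₄ : q ^ (6 : ℤ) / (q * q ^ (4 * m + 4)) = q ^ (1 - 4 * m : ℤ) := by
    rw [← pow_succ', ← zpow_natCast, ← zpow_sub₀ hq]
    congr 1; push_cast; ring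
  have shift : ∀ (a : ℤ) (i : ℕ), q ^ a * (q ^ 4) ^ i = q ^ (a + 4 * i) := fun a i => by
    rw [zpow_add₀ hq, ← pow_mul, ← zpow_natCast]
    norm_cast
  have hs := sum_veryWellPoisedTerm (A := q ^ 2) (b := q) (d := q ^ (4 * m + 4)) (p := q ^ 4)
    (by exact_mod_cast hE 2 two_ne_zero) hq (pow_ne_zero _ hq) (pow_ne_zero _ hq)
    (fun i => by
      rw [show q ^ 4 * (q ^ 4) ^ i = q ^ (4 + 4 * (i : ℤ)) by rw [← shift]; norm_cast]
      exact hE _ (by omega))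
    (fun i => by rw [z₁, z₂, shift]; exact hE _ (by omega))
    (fun i => by rw [z₁, z₃, shift]; exact hE _ (by omega))
    (fun i => by rw [z₁, shift]; exact hE _ (by omega)) m
  rw [z₁, z₂, z₃, z₄] at hs
  have hne : ∀ a : ℤ, (∀ i : ℕ, 4 * (i : ℤ) + a ≠ 0) →
      qShiftedFactorial (q ^ a) (q ^ 4) m ≠ 0 := fun a ha => by
    rw [qShiftedFactorial_zpow hq]
    exact Finset.prod_ne_zero_iff.mpr fun i _ => hE _ (ha i)
  have n₂ := hne 2 (fun i => by omega)
  have n₅ := hne 5 (fun i => by omega)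
  have n₆ := hne (2 - 4 * m) (fun i => by omega)
  have hr := prod_one_sub_zpow_reflect hq m
  have hI := qInteger_mul_one_sub (q ^ 2) (2 * m + 1)
  -- The quotient `(q^6;q^4)_m / (q^2;q^4)_m` is the `q`-integer `[2m+1]_{q^2}`.
  have h₆ : (1 - q ^ 2) * qShiftedFactorial (q ^ (6 : ℤ)) (q ^ 4) m =
      qShiftedFactorial (q ^ (2 : ℤ)) (q ^ 4) m * (1 - (q ^ 2) ^ (2 * m + 1)) := by
    have := qShiftedFactorial_succ' (q ^ (2 : ℤ)) (q ^ 4) m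
    rw [qShiftedFactorial_succ] at this
    rw [← z₁, show (q ^ 2) ^ (2 * m + 1) = q ^ 2 * (q ^ 4) ^ m by ring]
    exact_mod_cast this.symm
  have h₁ : (1 - q ^ 2) ≠ 0 := by exact_mod_cast hE 2 two_ne_zero
  have hexp : (1 - ((2 * m + 1 : ℕ) : ℤ)) / 2 = -m := by
    push_cast; omega
  rw [closedForm, hexp, show (2 * m + 1 - 1) / 2 = m by omega,
    show q ^ 3 = q ^ (3 : ℤ) by norm_cast, show q ^ 5 = q ^ (5 : ℤ) by norm_cast,
    Finset.sum_congr rfl fun k _ => deformedTerm_eq_veryWellPoisedTerm hq h m k,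
    div_mul_eq_mul_div, eq_div_iff n₅]
  apply mul_right_cancel₀ n₆
  rw [mul_assoc, hs]
  apply mul_left_cancel₀ h₁
  apply mul_right_cancel₀ n₂
  rw [← mul_assoc, h₆, ← hI]
  linear_combination qShiftedFactorial (q ^ (2 : ℤ)) (q ^ 4) m * qInteger (q ^ 2) (2 * m + 1) *
    (1 - q ^ 2) * hr

theorem deformedTerm_eq_zero (q : K) (m k : ℕ) (hk : m < k) :
    deformedTerm q (2 * m + 1) k = 0 := by
  rw [deformedTerm, Finset.prod_eq_zero (Finset.mem_range.mpr hk), mul_zero]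
  rw [deformationFactor, show (4 * (m : ℤ) + 2 - 2 * (2 * m + 1)) = 0 by ring]
  simp

end DeformedSeries

/-! ### Valuations of the deformation and of shifted factorials. -/

section CyclotomicValuation

variable {K Γ₀ : Type*} [Field K] [LinearOrderedCommGroupWithZero Γ₀]

/-- A valuation that behaves on the elements `1 - q ^ e` like the `Φ_d(q)`-adic valuation, with
`Φ_d(q)` of value `π`. -/
structure IsCyclotomicValuation (v : Valuation K Γ₀) (q : K) (d : ℕ) (π : Γ₀) : Prop where
  map_base : v q = 1
  map_of_not_dvd : ∀ e : ℤ, ¬(d : ℤ) ∣ e → v (1 - q ^ e) = 1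
  map_of_dvd : ∀ e : ℤ, e ≠ 0 → (d : ℤ) ∣ e → v (1 - q ^ e) = π
  ne_zero : π ≠ 0
  lt_one : π < 1

namespace IsCyclotomicValuation

variable {v : Valuation K Γ₀} {q : K} {d : ℕ} {π : Γ₀}

theorem base_ne_zero (h : IsCyclotomicValuation v q d π) : q ≠ 0 := by
  rintro rfl
  simpa using h.map_base

theorem map_eq_ite (h : IsCyclotomicValuation v q d π) {e : ℤ} (he : e ≠ 0) :
    v (1 - q ^ e) = if (d : ℤ) ∣ e then π else 1 := by
  split_ifs with hd
  exacts [h.map_of_dvd e he hd, h.map_of_not_dvd e hd]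

theorem map_ne_zero (h : IsCyclotomicValuation v q d π) {e : ℤ} (he : e ≠ 0) :
    v (1 - q ^ e) ≠ 0 := by
  rw [h.map_eq_ite he]
  split_ifs
  exacts [h.ne_zero, one_ne_zero]

theorem zpow_ne_one (h : IsCyclotomicValuation v q d π) (e : ℤ) (he : e ≠ 0) : q ^ e ≠ 1 := by
  intro h0
  exact h.map_ne_zero he (by simp [h0])

theorem map_zpow (h : IsCyclotomicValuation v q d π) (e : ℤ) : v (q ^ e) = 1 := by
  simp [h.map_base]

theorem sq_lt_one (h : IsCyclotomicValuation v q d π) : π ^ 2 < 1 :=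
  pow_lt_one₀ zero_le h.lt_one two_ne_zero

theorem map_one_add (h : IsCyclotomicValuation v q d π) (hd : Odd d) {e : ℤ} (he : e ≠ 0) :
    v (1 + q ^ e) = 1 := by
  have h₁ : v (1 + q ^ e) * v (1 - q ^ e) = v (1 - q ^ (2 * e)) := by
    rw [← map_mul, two_mul, zpow_add₀ h.base_ne_zero]
    ring_nf
  rw [h.map_eq_ite he, h.map_eq_ite (mul_ne_zero two_ne_zero he)] at h₁
  have h₂ : (d : ℤ) ∣ 2 * e ↔ (d : ℤ) ∣ e :=
    ⟨fun H => IsCoprime.dvd_of_dvd_mul_left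
      (by exact_mod_cast (Nat.coprime_two_right.mpr hd).isCoprime) H, fun H => H.mul_left 2⟩
  simp only [h₂] at h₁
  split_ifs at h₁
  · exact mul_right_cancel₀ h.ne_zero (h₁.trans (one_mul π).symm)
  · simpa using h₁

/-- Deformation factors are units. -/
theorem map_deformationFactor (h : IsCyclotomicValuation v q d π) {N e : ℤ} (hN : (d : ℤ) ∣ N)
    (he : e ≠ 0) (h₁ : e ≠ 2 * N) (h₂ : e ≠ -(2 * N)) : v (deformationFactor q N e) = 1 := by
  rw [deformationFactor, map_div₀, map_mul, map_pow, h.map_eq_ite he,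
    h.map_eq_ite (sub_ne_zero.mpr h₁), h.map_eq_ite (by omega)]
  have d₁ : (d : ℤ) ∣ e - 2 * N ↔ (d : ℤ) ∣ e := dvd_sub_left (hN.mul_left 2)
  have d₂ : (d : ℤ) ∣ e + 2 * N ↔ (d : ℤ) ∣ e := dvd_add_left (hN.mul_left 2)
  simp only [d₁, d₂]
  have := h.ne_zero
  split_ifs
  · rw [← sq, div_self (pow_ne_zero 2 this)]
  · simp

/-- The difference is exactly `-q^(e-2N) * ((1 - q^(2N)) / (1 - q^e))^2`, with unit denominator. -/
theorem map_deformationFactor_sub_one (h : IsCyclotomicValuation v q d π) {N e : ℤ} (hN0 : N ≠ 0)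
    (hN : (d : ℤ) ∣ N) (he : ¬(d : ℤ) ∣ e) : v (deformationFactor q N e - 1) ≤ π ^ 2 := by
  have hq := h.base_ne_zero
  have he0 : e ≠ 0 := by
    rintro rfl
    simp at he
  have hne := one_sub_zpow_ne_zero h.zpow_ne_one he0
  have key : deformationFactor q N e - 1 =
      -(q ^ (e - 2 * N) * (1 - q ^ (2 * N)) ^ 2 / (1 - q ^ e) ^ 2) := by
    rw [deformationFactor]
    have e₁ : q ^ e = q ^ (e - 2 * N) * q ^ (2 * N) := by
      rw [← zpow_add₀ hq, sub_add_cancel]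
    rw [zpow_add₀ hq]
    field_simp
    rw [e₁]
    ring
  rw [key, Valuation.map_neg, map_div₀, map_mul, map_pow, map_pow, h.map_zpow,
    h.map_of_not_dvd e he, h.map_of_dvd _ (by omega) (hN.mul_left 2)]
  simp

theorem map_deformationFactor_div_sub_one (h : IsCyclotomicValuation v q d π) {N e f : ℤ}
    (hN0 : N ≠ 0) (hN : (d : ℤ) ∣ N) (he : ¬(d : ℤ) ∣ e) (hf : ¬(d : ℤ) ∣ f) :
    v (deformationFactor q N e / deformationFactor q N f - 1) ≤ π ^ 2 := by
  have hdvd : ∀ x : ℤ, x = 0 ∨ x = 2 * N ∨ x = -(2 * N) → (d : ℤ) ∣ x := by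
    rintro x (rfl | rfl | rfl)
    exacts [dvd_zero _, hN.mul_left 2, (hN.mul_left 2).neg_right]
  have hf₁ : v (deformationFactor q N f) = 1 :=
    h.map_deformationFactor hN (fun H => hf (hdvd f (.inl H)))
      (fun H => hf (hdvd f (.inr (.inl H)))) (fun H => hf (hdvd f (.inr (.inr H))))
  have hf₀ : deformationFactor q N f ≠ 0 := by
    intro H
    simp [H] at hf₁
  rw [div_sub_one hf₀, map_div₀, hf₁, div_one,
    show deformationFactor q N e - deformationFactor q N f =
      (deformationFactor q N e - 1) - (deformationFactor q N f - 1) by ring]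
  exact v.map_sub_le (h.map_deformationFactor_sub_one hN0 hN he)
    (h.map_deformationFactor_sub_one hN0 hN hf)

end IsCyclotomicValuation

theorem Valuation.map_prod_sub_one_le {ι : Type*} (v : Valuation K Γ₀) {c : Γ₀} (hc : c ≤ 1)
    (s : Finset ι) (f : ι → K) (hf : ∀ i ∈ s, v (f i - 1) ≤ c) : v (∏ i ∈ s, f i - 1) ≤ c := by
  classical
  induction s using Finset.induction_on with
  | empty => simp
  | insert a s ha ih =>
    rw [Finset.prod_insert ha, show f a * ∏ i ∈ s, f i - 1 =
      f a * (∏ i ∈ s, f i - 1) + (f a - 1) by ring]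
    have h₁ := hf a (Finset.mem_insert_self a s)
    have h₂ := ih fun i hi => hf i (Finset.mem_insert_of_mem hi)
    have h₃ : v (f a) ≤ 1 := by
      have := v.map_add (f a - 1) 1
      rw [sub_add_cancel, map_one] at this
      exact this.trans (max_le (h₁.trans hc) le_rfl)
    refine v.map_add_le ?_ h₁
    rw [map_mul]
    exact mul_le_of_le_one_of_le h₃ h₂

theorem Finset.prod_range_mul_add_of_periodic {M : Type*} [CommMonoid M] {f : ℕ → M} {d : ℕ}
    (hf : ∀ i, f (i + d) = f i) (a b : ℕ) :
    ∏ i ∈ Finset.range (a * d + b), f i =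
      (∏ i ∈ Finset.range d, f i) ^ a * ∏ i ∈ Finset.range b, f i := by
  have hper : ∀ a i, f (a * d + i) = f i := fun a i => by
    induction a with
    | zero => simp
    | succ a ih => rw [add_mul, one_mul, add_right_comm, hf, ih]
  rw [Finset.prod_range_add]
  simp only [hper]
  congr 1
  induction a with
  | zero => simp
  | succ a ih =>
    rw [add_mul, one_mul, Finset.prod_range_add, ih, pow_succ]
    simp only [hper]

namespace IsCyclotomicValuation

variable {v : Valuation K Γ₀} {q : K} {d : ℕ} {π : Γ₀}

/-- The values of the factors have period `d`, and each period contains one non-unit, at `j₀`. -/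
theorem map_qShiftedFactorial (h : IsCyclotomicValuation v q d π) {c : ℤ} (hc : 0 < c) {j₀ : ℕ}
    (hj₀ : j₀ < d) (hj : ∀ j < d, (d : ℤ) ∣ 4 * j + c ↔ j = j₀) (a : ℕ) {b : ℕ} (hb : b ≤ d) :
    v (qShiftedFactorial (q ^ c) (q ^ 4) (a * d + b)) = π ^ a * if j₀ < b then π else 1 := by
  have part : ∀ b ≤ d, (∏ i ∈ Finset.range b, if (d : ℤ) ∣ 4 * (i : ℤ) + c then π else 1) =
      if j₀ < b then π else 1 := fun b hb => by
    rw [Finset.prod_congr rfl fun i hi => by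
      rw [if_congr (hj i ((Finset.mem_range.mp hi).trans_le hb)) rfl rfl], Finset.prod_ite_eq']
    simp
  rw [qShiftedFactorial_zpow h.base_ne_zero, map_prod,
    Finset.prod_congr rfl fun (i : ℕ) _ => h.map_eq_ite (show 4 * (i : ℤ) + c ≠ 0 by omega),
    Finset.prod_range_mul_add_of_periodic, part d le_rfl, part b hb, if_pos hj₀]
  intro i
  refine if_congr ?_ rfl rfl
  rw [show 4 * ((i + d : ℕ) : ℤ) + c = 4 * (i : ℤ) + c + d * 4 by push_cast; ring]
  exact dvd_add_left (dvd_mul_right _ _)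

end IsCyclotomicValuation

/-- The residue `j₀` solves `4 * j + c ≡ 0` modulo the odd number `d` if it solves it at all. -/
theorem dvd_four_mul_add_iff {d : ℕ} (hd : Odd d) {c : ℤ} {j₀ : ℕ} (hj₀ : j₀ < d)
    (h : (d : ℤ) ∣ 4 * j₀ + c) {j : ℕ} (hj : j < d) : (d : ℤ) ∣ 4 * j + c ↔ j = j₀ := by
  refine ⟨fun H => ?_, fun H => H ▸ h⟩
  have h₁ : (d : ℤ) ∣ 4 * ((j : ℤ) - j₀) := by
    have := dvd_sub H h
    rwa [show 4 * (j : ℤ) + c - (4 * j₀ + c) = 4 * ((j : ℤ) - j₀) by ring] at this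
  have hcop : IsCoprime (d : ℤ) 4 := by
    have : Nat.Coprime d 4 := (Nat.coprime_two_right.mpr hd).pow_right 2
    exact_mod_cast this.isCoprime
  have h₂ := Int.eq_zero_of_abs_lt_dvd (hcop.dvd_of_dvd_mul_left h₁) (by rw [abs_lt]; omega)
  omega

end CyclotomicValuation

/-! ### Congruences modulo the square of one cyclotomic polynomial. -/

section LocalCongruences

variable {K Γ₀ : Type*} [Field K] [LinearOrderedCommGroupWithZero Γ₀]

theorem Finset.sum_range_mul_eq_sum_sum {M : Type*} [AddCommMonoid M] (f : ℕ → M) (a d : ℕ) :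
    ∑ k ∈ Finset.range (a * d), f k =
      ∑ i ∈ Finset.range a, ∑ j ∈ Finset.range d, f (i * d + j) := by
  induction a with
  | zero => simp
  | succ a ih => rw [add_mul, one_mul, Finset.sum_range_add, ih, Finset.sum_range_succ]

/-- The sum of the `a`-th block of `d` consecutive summands of `truncatedSum`. -/
def blockSum (q : K) (d a : ℕ) : K :=
  ∑ b ∈ Finset.range d, seriesTerm q (a * d + b)

/-- The factor by which the `a`-th block of summands changes, to second order, under
deformation. -/
def blockFactor (q : K) (d : ℕ) (N : ℤ) (a : ℕ) : K :=
  ∏ i ∈ Finset.range (a * d),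
    deformationFactor q N (4 * i + 2) / deformationFactor q N (4 * i + 4)

namespace IsCyclotomicValuation

variable {v : Valuation K Γ₀} {q : K} {d : ℕ} {π : Γ₀}

/-- In each block the numerator product acquires its non-unit factor at index `(d-1)/2`, the
denominator product only at `d-1`. Between the two there is one surplus factor, cubed. -/
theorem map_seriesTerm (h : IsCyclotomicValuation v q d π) (hd : Odd d) (a : ℕ) {b : ℕ}
    (hb : b < d) : v (seriesTerm q (a * d + b)) = if (d - 1) / 2 < b then π ^ 3 else 1 := by
  obtain ⟨e, he⟩ := hd
  have hd : Odd d := ⟨e, he⟩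
  have h₂ := h.map_qShiftedFactorial (c := 2) two_pos (j₀ := (d - 1) / 2) (by omega)
    (fun j hj => dvd_four_mul_add_iff hd (by omega) ⟨2, by omega⟩ hj) a hb.le
  have h₄ := h.map_qShiftedFactorial (c := 4) four_pos (j₀ := d - 1) (by omega)
    (fun j hj => dvd_four_mul_add_iff hd (by omega) ⟨4, by omega⟩ hj) a hb.le
  rw [if_neg (by omega : ¬ d - 1 < b), mul_one] at h₄
  have c₂ : q ^ (2 : ℤ) = q ^ 2 := by norm_cast
  have c₄ : q ^ (4 : ℤ) = q ^ 4 := by norm_cast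
  rw [c₂] at h₂
  rw [c₄] at h₄
  have n₁ : v (1 + q ^ (4 * (a * d + b) + 1)) = 1 := by
    exact_mod_cast h.map_one_add hd (e := ((4 * (a * d + b) + 1 : ℕ) : ℤ)) (by omega)
  have n₂ : v (1 + q) = 1 := by simpa using h.map_one_add hd (e := 1) one_ne_zero
  have hπ : π ^ a ≠ 0 := pow_ne_zero a h.ne_zero
  rw [seriesTerm, map_mul, map_div₀, map_mul, map_mul, map_pow, map_pow, map_pow, n₁, n₂, h₂, h₄,
    h.map_base]
  split_ifs
  · rw [one_pow, mul_one, one_mul, one_mul, mul_pow, mul_div_cancel_left₀ _ (pow_ne_zero 3 hπ)]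
  · rw [one_pow, mul_one, one_mul, one_mul, mul_one, div_self (pow_ne_zero 3 hπ)]

theorem cube_le_sq (h : IsCyclotomicValuation v q d π) : π ^ 3 ≤ π ^ 2 :=
  pow_le_pow_right_of_le_one' h.lt_one.le (by norm_num)

theorem map_deformationFactor_add_four (h : IsCyclotomicValuation v q d π) {N : ℤ} (hodd : Odd N)
    (hN : (d : ℤ) ∣ N) (i : ℕ) : v (deformationFactor q N (4 * i + 4)) = 1 := by
  obtain ⟨s, rfl⟩ := hodd
  exact h.map_deformationFactor hN (by omega) (by omega) (by omega)

theorem map_deformationFactor_add_two (h : IsCyclotomicValuation v q d π) {N : ℤ} (hN0 : 0 < N)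
    (hN : (d : ℤ) ∣ N) {i : ℕ} (hi : (2 * i + 1 : ℤ) ≠ N) :
    v (deformationFactor q N (4 * i + 2)) = 1 :=
  h.map_deformationFactor hN (by omega) (by omega) (by omega)

theorem map_deformationFactor_add_two_le (h : IsCyclotomicValuation v q d π) {N : ℤ} (hN0 : 0 < N)
    (hN : (d : ℤ) ∣ N) (i : ℕ) : v (deformationFactor q N (4 * i + 2)) ≤ 1 := by
  by_cases hi : (2 * i + 1 : ℤ) = N
  · rw [deformationFactor, show 4 * (i : ℤ) + 2 - 2 * N = 0 by omega]
    simp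
  · exact (h.map_deformationFactor_add_two hN0 hN hi).le

theorem map_blockFactor (h : IsCyclotomicValuation v q d π) (hd : Odd d) {s a : ℕ}
    (ha : a ≤ s) : v (blockFactor q d (d * (2 * s + 1)) a) = 1 := by
  have hpos : (0 : ℤ) < d * (2 * s + 1) := by
    have := hd.pos
    positivity
  have hodd : Odd ((d : ℤ) * (2 * s + 1)) := by
    have : Odd (d : ℤ) := by exact_mod_cast hd
    exact this.mul ⟨s, rfl⟩
  rw [blockFactor, map_prod]
  refine Finset.prod_eq_one fun i hi => ?_
  have hi' : (i : ℤ) < a * d := by exact_mod_cast Finset.mem_range.mp hi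
  have has : (a : ℤ) * d ≤ s * d := by exact_mod_cast Nat.mul_le_mul_right d ha
  rw [map_div₀, h.map_deformationFactor_add_four hodd (dvd_mul_right _ _),
    h.map_deformationFactor_add_two hpos (dvd_mul_right _ _), div_one]
  -- The vanishing numerator sits at `2i+1 = N`, in the middle of block `s`, hence beyond the range
  -- `i < a * d`.
  have : (d : ℤ) * (2 * s + 1) = 2 * (s * d) + d := by ring
  omega

theorem map_deformedTerm_sub_le (h : IsCyclotomicValuation v q d π) (hd : Odd d) {s a b : ℕ}
    (ha : a ≤ s) (hb : b < d) :
    v (deformedTerm q (d * (2 * s + 1)) (a * d + b) -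
      blockFactor q d (d * (2 * s + 1)) a * seriesTerm q (a * d + b)) ≤ π ^ 2 := by
  have hpos : (0 : ℤ) < d * (2 * s + 1) := by
    have := hd.pos
    positivity
  have hodd : Odd ((d : ℤ) * (2 * s + 1)) := by
    have : Odd (d : ℤ) := by exact_mod_cast hd
    exact this.mul ⟨s, rfl⟩
  have hdvd : (d : ℤ) ∣ d * (2 * s + 1) := dvd_mul_right _ _
  have hB := h.map_blockFactor hd ha
  have hP := h.map_seriesTerm hd a hb
  obtain ⟨e, he⟩ := hd
  split_ifs at hP with hlt
  · refine v.map_sub_le ?_ ?_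
    · rw [deformedTerm, map_mul, hP, map_prod]
      refine (mul_le_of_le_one_right' (Finset.prod_le_one' fun i _ => ?_)).trans h.cube_le_sq
      rw [map_div₀, h.map_deformationFactor_add_four hodd hdvd, div_one]
      exact h.map_deformationFactor_add_two_le hpos hdvd i
    · rw [map_mul, hB, hP, one_mul]
      exact h.cube_le_sq
  · rw [deformedTerm, Finset.prod_range_add, ← blockFactor,
      show ∀ x y z : K, x * (y * z) - y * x = y * x * (z - 1) by intros; ring, map_mul, map_mul,
      hB, hP, one_mul, one_mul]
    refine v.map_prod_sub_one_le h.sq_lt_one.le _ _ fun i hi => ?_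
    have hi' := Finset.mem_range.mp hi
    -- In the first half of a block `2i+1` and `i+1` lie strictly between `0` and `d`, so neither
    -- exponent is divisible by `d`.
    have nd : ∀ x : ℤ, 0 < x → x < d → ∀ y : ℤ, ¬ (d : ℤ) ∣ y * d + x := fun x h0 h1 y H =>
      absurd (Int.le_of_dvd h0 ((dvd_add_right (dvd_mul_left _ _)).mp H)) (by omega)
    have hcop : IsCoprime (d : ℤ) 2 := ⟨1, -e, by push_cast [he]; ring⟩
    refine h.map_deformationFactor_div_sub_one hpos.ne' hdvd (fun H => ?_) (fun H => ?_)
    · refine nd (2 * i + 1) (by omega) (by omega) (2 * a) (hcop.dvd_of_dvd_mul_left (?_ :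
        (d : ℤ) ∣ 2 * _))
      convert H using 1
      push_cast
      ring
    · refine nd (i + 1) (by omega) (by omega) a (hcop.dvd_of_dvd_mul_left (hcop.dvd_of_dvd_mul_left
        (?_ : (d : ℤ) ∣ 2 * (2 * _))))
      convert H using 1
      push_cast
      ring

/-- The deformed series, summed in closed form, compared with the blocks of the original one. -/
theorem map_sum_blockFactor_mul_blockSum_sub_le (h : IsCyclotomicValuation v q d π) (hd : Odd d)
    (s : ℕ) :
    v (∑ a ∈ Finset.range (s + 1), blockFactor q d (d * (2 * s + 1)) a * blockSum q d a -
      closedForm q (d * (2 * s + 1))) ≤ π ^ 2 := by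
  obtain ⟨e, he⟩ := hd
  have hd : Odd d := ⟨e, he⟩
  have hm : d * (2 * s + 1) = 2 * (s * d + e) + 1 := by
    rw [he]; ring
  have hmz : (d : ℤ) * (2 * s + 1) = 2 * ((s * d + e : ℕ) : ℤ) + 1 := by exact_mod_cast hm
  have hsum : closedForm q (d * (2 * s + 1)) = ∑ a ∈ Finset.range (s + 1),
      ∑ b ∈ Finset.range d, deformedTerm q (d * (2 * s + 1)) (a * d + b) := by
    rw [← Finset.sum_range_mul_eq_sum_sum, hm, hmz,
      ← sum_deformedTerm h.base_ne_zero h.zpow_ne_one]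
    -- The terminating sum stops in mid-block; the vanishing deformed terms complete it.
    refine Finset.sum_subset (fun i hi => ?_) fun i _ hi => ?_
    · rw [Finset.mem_range] at hi ⊢
      rw [add_mul, one_mul]
      omega
    · rw [Finset.mem_range] at hi
      exact deformedTerm_eq_zero q _ i (by omega)
  rw [hsum, ← Finset.sum_sub_distrib]
  refine v.map_sum_le fun a ha => ?_
  rw [blockSum, Finset.mul_sum, ← Finset.sum_sub_distrib]
  refine v.map_sum_le fun b hb => ?_
  rw [Valuation.map_sub_swap]
  exact h.map_deformedTerm_sub_le hd (Nat.lt_succ_iff.mp (Finset.mem_range.mp ha))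
    (Finset.mem_range.mp hb)

/-- Truncating in the middle of a block instead of at its end makes no difference to second
order. -/
theorem map_truncatedSum_half_sub_le (h : IsCyclotomicValuation v q d π) (hd : Odd d) (s : ℕ) :
    v (truncatedSum q ((d * (2 * s + 1) - 1) / 2) -
      ∑ a ∈ Finset.range (s + 1), blockSum q d a) ≤ π ^ 2 := by
  obtain ⟨e, he⟩ := hd
  have hd : Odd d := ⟨e, he⟩
  have hm : (d * (2 * s + 1) - 1) / 2 + 1 = s * d + (e + 1) := by
    rw [show d * (2 * s + 1) = 2 * (s * d + e) + 1 by rw [he]; ring]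
    omega
  rw [truncatedSum_eq_sum, hm, Finset.sum_range_add, Finset.sum_range_mul_eq_sum_sum,
    Finset.sum_range_succ _ s]
  simp only [blockSum]
  rw [add_sub_add_left_eq_sub, ← Finset.sum_range_add_sum_Ico _ (by omega : e + 1 ≤ d),
    sub_add_cancel_left, Valuation.map_neg]
  refine v.map_sum_le fun b hb => ?_
  rw [Finset.mem_Ico] at hb
  rw [h.map_seriesTerm hd s hb.2, if_pos (by omega)]
  exact h.cube_le_sq

/-- The `q`-integer gives one `π`. Since `d ≡ 3 (mod 4)`, `(q^3;q^4)` has its non-unit at `(d-3)/4`,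
inside the final half block, while `(q^5;q^4)` has it at `(3d-5)/4`, outside; this gives the second
`π`. -/
theorem map_closedForm (h : IsCyclotomicValuation v q d π) (hd : d % 4 = 3) (s : ℕ) :
    v (closedForm q (d * (2 * s + 1))) = π ^ 2 := by
  have hodd : Odd d := Nat.odd_iff.mpr (by omega)
  have hm : (d * (2 * s + 1) - 1) / 2 = s * d + (d - 1) / 2 := by
    obtain ⟨e, rfl⟩ := hodd
    rw [show (2 * e + 1) * (2 * s + 1) = 2 * (s * (2 * e + 1) + e) + 1 by ring]
    omega
  have h₃ := h.map_qShiftedFactorial (c := 3) three_pos (j₀ := (d - 3) / 4) (by omega)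
    (fun j hj => dvd_four_mul_add_iff hodd (by omega) ⟨1, by omega⟩ hj) s
    (show (d - 1) / 2 ≤ d by omega)
  have h₅ := h.map_qShiftedFactorial (c := 5) (by norm_num) (j₀ := (3 * d - 5) / 4) (by omega)
    (fun j hj => dvd_four_mul_add_iff hodd (by omega) ⟨3, by omega⟩ hj) s
    (show (d - 1) / 2 ≤ d by omega)
  rw [if_pos (by omega)] at h₃
  rw [if_neg (by omega), mul_one] at h₅
  have hI : v (qInteger (q ^ 2) (d * (2 * s + 1))) = π := by
    have := congrArg v (qInteger_mul_one_sub (q ^ 2) (d * (2 * s + 1)))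
    rw [map_mul, ← pow_mul] at this
    have h₁ : v (1 - q ^ 2) = 1 := by
      exact_mod_cast h.map_of_not_dvd 2 (fun H => by
        have := Int.le_of_dvd two_pos H
        omega)
    have h₂ : v (1 - q ^ (2 * (d * (2 * s + 1)))) = π := by
      exact_mod_cast h.map_of_dvd ((2 * (d * (2 * s + 1)) : ℕ) : ℤ)
        (by have := hodd.pos; positivity) ⟨2 * (2 * s + 1), by push_cast; ring⟩
    rwa [h₁, h₂, mul_one] at this
  have hπ : π ^ s ≠ 0 := pow_ne_zero s h.ne_zero
  rw [closedForm, hm, map_mul, map_div₀, map_mul, hI, h.map_zpow, mul_one,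
    show q ^ 3 = q ^ (3 : ℤ) by norm_cast, show q ^ 5 = q ^ (5 : ℤ) by norm_cast, h₃, h₅,
    mul_left_comm, mul_div_cancel_left₀ _ hπ, sq]

/-- Use the block comparison with `N = d * (2a+1)`: the earlier blocks are small by induction, and
block `a` enters last with a unit coefficient. -/
theorem map_blockSum_le (h : IsCyclotomicValuation v q d π) (hd : d % 4 = 3) (a : ℕ) :
    v (blockSum q d a) ≤ π ^ 2 := by
  have hodd : Odd d := Nat.odd_iff.mpr (by omega)
  induction a using Nat.strong_induction_on with
  | _ a ih =>
    have h₁ := h.map_sum_blockFactor_mul_blockSum_sub_le hodd a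
    have h₂ := v.map_add_le h₁ (h.map_closedForm hd a).le
    rw [sub_add_cancel, Finset.sum_range_succ] at h₂
    have h₃ : v (∑ i ∈ Finset.range a, blockFactor q d (d * (2 * a + 1)) i * blockSum q d i) ≤
        π ^ 2 := v.map_sum_le fun i hi => by
      have hi' := Finset.mem_range.mp hi
      rw [map_mul, h.map_blockFactor hodd hi'.le, one_mul]
      exact ih i hi'
    have h₄ := v.map_sub_le h₂ h₃
    rwa [add_sub_cancel_left, map_mul, h.map_blockFactor hodd le_rfl, one_mul] at h₄

theorem map_truncatedSum_half_sub_closedForm_le (h : IsCyclotomicValuation v q d π)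
    (hd : d % 4 = 3) (s : ℕ) :
    v (truncatedSum q ((d * (2 * s + 1) - 1) / 2) - closedForm q (d * (2 * s + 1))) ≤ π ^ 2 := by
  refine v.map_sub_le ?_ (h.map_closedForm hd s).le
  have := v.map_add_le (h.map_truncatedSum_half_sub_le (Nat.odd_iff.mpr (by omega)) s)
    (v.map_sum_le fun a (_ : a ∈ Finset.range (s + 1)) => h.map_blockSum_le hd a)
  rwa [sub_add_cancel] at this

theorem map_truncatedSum_sub_closedForm_le (h : IsCyclotomicValuation v q d π)
    (hd : d % 4 = 3) (s : ℕ) :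
    v (truncatedSum q (d * (2 * s + 1) - 1) - closedForm q (d * (2 * s + 1))) ≤ π ^ 2 := by
  refine v.map_sub_le ?_ (h.map_closedForm hd s).le
  have hpos : 0 < d * (2 * s + 1) := Nat.mul_pos (by omega) (by omega)
  rw [truncatedSum_eq_sum, Nat.sub_add_cancel hpos, mul_comm d, Finset.sum_range_mul_eq_sum_sum]
  exact v.map_sum_le fun a _ => h.map_blockSum_le hd a

theorem map_blockSum_zero_sub_closedForm_le (h : IsCyclotomicValuation v q d π) (hd : Odd d) :
    v (blockSum q d 0 - closedForm q d) ≤ π ^ 2 := by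
  simpa [blockFactor] using h.map_sum_blockFactor_mul_blockSum_sub_le hd 0

theorem map_truncatedSum_half_sub_closedForm_le_self (h : IsCyclotomicValuation v q d π)
    (hd : Odd d) : v (truncatedSum q ((d - 1) / 2) - closedForm q d) ≤ π ^ 2 := by
  have := v.map_add_le (h.map_truncatedSum_half_sub_le hd 0)
    (by simpa using h.map_blockSum_zero_sub_closedForm_le hd)
  simpa using this

theorem map_truncatedSum_sub_closedForm_le_self (h : IsCyclotomicValuation v q d π)
    (hd : Odd d) : v (truncatedSum q (d - 1) - closedForm q d) ≤ π ^ 2 := by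
  rw [truncatedSum_eq_sum, Nat.sub_add_cancel hd.pos]
  simpa [blockSum] using h.map_blockSum_zero_sub_closedForm_le hd

end IsCyclotomicValuation

end LocalCongruences

/-! ### Realisation by the `Φ_d`-adic valuation on `ℚ(X)`. -/

section CyclotomicAdicValuation

open IsDedekindDomain WithZero

/-- The prime ideal of `ℚ[X]` generated by `Φ_d`. -/
noncomputable def cyclotomicPrime (d : ℕ) (hd : 0 < d) : HeightOneSpectrum ℚ[X] where
  asIdeal := Ideal.span {cyclotomic d ℚ}
  isPrime := (Ideal.span_singleton_prime (cyclotomic_ne_zero d ℚ)).mpr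
    (cyclotomic.irreducible_rat hd).prime
  ne_bot := by simpa using cyclotomic_ne_zero d ℚ

variable {d : ℕ} (hd : 0 < d)

/-- The `Φ_d`-adic valuation on `ℚ(X)`. -/
noncomputable def cyclotomicValuation : Valuation (RatFunc ℚ) ℤᵐ⁰ :=
  (cyclotomicPrime d hd).valuation (RatFunc ℚ)

theorem cyclotomicValuation_eq_one_iff {f : ℚ[X]} :
    cyclotomicValuation hd (algebraMap _ _ f) = 1 ↔ ¬cyclotomic d ℚ ∣ f := by
  rw [cyclotomicValuation, HeightOneSpectrum.valuation_eq_one_iff_notMem, cyclotomicPrime,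
    Ideal.mem_span_singleton]

theorem cyclotomicValuation_le_exp_iff {f : ℚ[X]} {k : ℕ} :
    cyclotomicValuation hd (algebraMap _ _ f) ≤ exp (-k : ℤ) ↔ cyclotomic d ℚ ^ k ∣ f := by
  rw [cyclotomicValuation, HeightOneSpectrum.valuation_of_algebraMap,
    HeightOneSpectrum.intValuation_le_pow_iff_dvd, cyclotomicPrime, Ideal.span_singleton_pow,
    Ideal.dvd_span_singleton, Ideal.mem_span_singleton]

theorem cyclotomicValuation_cyclotomic {c : ℕ} :
    cyclotomicValuation hd (algebraMap _ _ (cyclotomic c ℚ)) = if c = d then exp (-1) else 1 := by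
  split_ifs with h
  · subst h
    rw [cyclotomicValuation, HeightOneSpectrum.valuation_of_algebraMap]
    exact HeightOneSpectrum.intValuation_singleton _ (cyclotomic_ne_zero c ℚ) rfl
  · rw [cyclotomicValuation_eq_one_iff]
    intro H
    exact (cyclotomic.irreducible_rat hd).not_isUnit
      ((cyclotomic.isCoprime_rat (Ne.symm h)).isUnit_of_dvd H)

theorem cyclotomicValuation_one_sub_X_pow {k : ℕ} (hk : 0 < k) :
    cyclotomicValuation hd (1 - RatFunc.X ^ k) = if d ∣ k then exp (-1) else 1 := by
  rw [Valuation.map_sub_swap, ← RatFunc.algebraMap_X, ← map_pow, ← map_one (algebraMap ℚ[X] _),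
    ← map_sub, ← prod_cyclotomic_eq_X_pow_sub_one hk, map_prod, map_prod]
  simp only [cyclotomicValuation_cyclotomic, Finset.prod_ite_eq', Nat.mem_divisors, hk.ne',
    ne_eq, not_false_eq_true, and_true]

theorem cyclotomicValuation_X : cyclotomicValuation hd RatFunc.X = 1 := by
  rw [← RatFunc.algebraMap_X, cyclotomicValuation_eq_one_iff]
  intro h
  have h₁ := dvd_sub (dvd_pow h hd.ne') (cyclotomic.dvd_X_pow_sub_one d ℚ)
  rw [sub_sub_cancel] at h₁
  exact (cyclotomic.irreducible_rat hd).not_isUnit (isUnit_of_dvd_one h₁)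

theorem isCyclotomicValuation_cyclotomicValuation :
    IsCyclotomicValuation (cyclotomicValuation hd) RatFunc.X d (exp (-1)) := by
  have key : ∀ e : ℤ, e ≠ 0 → cyclotomicValuation hd (1 - RatFunc.X ^ e) =
      if (d : ℤ) ∣ e then exp (-1) else 1 := fun e he => by
    obtain ⟨k, rfl | rfl⟩ := e.eq_nat_or_neg
    · rw [zpow_natCast, cyclotomicValuation_one_sub_X_pow hd (by omega)]
      simp only [Int.natCast_dvd_natCast]
    · have hX : (RatFunc.X : RatFunc ℚ) ^ k ≠ 0 := pow_ne_zero k RatFunc.X_ne_zero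
      rw [zpow_neg, zpow_natCast, Valuation.map_sub_swap,
        show ((RatFunc.X : RatFunc ℚ) ^ k)⁻¹ - 1 = (1 - RatFunc.X ^ k) / RatFunc.X ^ k by field_simp,
        map_div₀, map_pow,
        cyclotomicValuation_X, one_pow, div_one,
        cyclotomicValuation_one_sub_X_pow hd (by omega)]
      simp only [dvd_neg, Int.natCast_dvd_natCast]
  refine ⟨cyclotomicValuation_X hd, fun e he => ?_, fun e he hde => ?_, exp_ne_zero, ?_⟩
  · rw [key e (by rintro rfl; simp at he), if_neg he]
  · rw [key e he, if_pos hde]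
  · rw [← exp_zero, exp_lt_exp]
    norm_num

/-- In lowest terms `Φ_d` cannot divide the denominator, as the value would then exceed `1`; so the
bound passes to the numerator. -/
theorem cyclotomic_sq_dvd_num {x : RatFunc ℚ} (h : cyclotomicValuation hd x ≤ exp (-1) ^ 2) :
    cyclotomic d ℚ ^ 2 ∣ x.num := by
  have hv := isCyclotomicValuation_cyclotomicValuation hd
  have hden : ¬cyclotomic d ℚ ∣ x.denom := by
    intro hdvd
    have hnum : ¬cyclotomic d ℚ ∣ x.num := fun hn =>
      (cyclotomic.irreducible_rat hd).not_isUnit (x.isCoprime_num_denom.isUnit_of_dvd' hn hdvd)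
    rw [← x.num_div_denom, map_div₀, (cyclotomicValuation_eq_one_iff hd).mpr hnum] at h
    have h₁ : cyclotomicValuation hd (algebraMap _ _ x.denom) ≤ exp (-1) := by
      simpa using (cyclotomicValuation_le_exp_iff hd (k := 1)).mpr (by simpa using hdvd)
    have h₂ : cyclotomicValuation hd (algebraMap _ _ x.denom) ≠ 0 := by
      simpa using x.denom_ne_zero
    rw [div_le_iff₀ (zero_lt_iff.mpr h₂)] at h
    exact absurd h (not_le_of_gt (mul_lt_one_of_lt_of_le hv.sq_lt_one (h₁.trans hv.lt_one.le)))
  rw [← x.num_div_denom, map_div₀, (cyclotomicValuation_eq_one_iff hd).mpr hden, div_one] at h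
  have := (cyclotomicValuation_le_exp_iff hd (f := x.num) (k := 2)).mp
  exact this (h.trans_eq (by rw [← exp_nsmul]; norm_num))

end CyclotomicAdicValuation

/-! ### Assembling the coprime moduli. -/

theorem ratCongr_of_cyclotomic_sq_dvd {n r : ℕ} (hn : 2 ≤ n) {A B : RatFunc ℚ}
    (h₀ : cyclotomic (n ^ (2 * r)) ℚ ^ 2 ∣ (A - B).num)
    (h₁ : ∀ j ∈ Finset.Icc 1 r, cyclotomic (n ^ (2 * j - 1)) ℚ ^ 2 ∣ (A - B).num) :
    RatCongr (cyclotomic (n ^ (2 * r)) ℚ ^ 2 *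
      ∏ j ∈ Finset.Icc 1 r, cyclotomic (n ^ (2 * j - 1)) ℚ ^ 2) A B := by
  have hcop : ∀ a b : ℕ, a ≠ b →
      IsCoprime (cyclotomic (n ^ a) ℚ ^ 2) (cyclotomic (n ^ b) ℚ ^ 2) := fun a b hab =>
    (cyclotomic.isCoprime_rat fun H => hab (Nat.pow_right_injective hn H)).pow
  refine IsCoprime.mul_dvd (IsCoprime.prod_right fun j hj => hcop _ _ ?_) h₀
    (Finset.prod_dvd_of_coprime (fun i hi j hj hij => hcop _ _ ?_) h₁)
  · have := Finset.mem_Icc.mp hj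
    omega
  · have := Finset.mem_Icc.mp (Finset.mem_coe.mp hi)
    have := Finset.mem_Icc.mp (Finset.mem_coe.mp hj)
    omega

theorem pow_odd_mod_four {n : ℕ} (hn : n % 4 = 3) (k : ℕ) : n ^ (2 * k + 1) % 4 = 3 := by
  have h : n ^ 2 % 4 = 1 := by
    simp [Nat.pow_mod, hn]
  rw [pow_succ, pow_mul, Nat.mul_mod, Nat.pow_mod, h, hn]
  simp

theorem theorem3 (n r : ℕ) (hn : n % 4 = 3) (hr : 1 ≤ r) :
    RatCongr
      (cyclotomic (n ^ (2 * r)) ℚ ^ 2 * ∏ j ∈ Finset.Icc 1 r, cyclotomic (n ^ (2 * j - 1)) ℚ ^ 2)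
      (truncatedSum (RatFunc.X : RatFunc ℚ) ((n ^ (2 * r) - 1) / 2))
      (closedForm (RatFunc.X : RatFunc ℚ) (n ^ (2 * r))) ∧
    RatCongr
      (cyclotomic (n ^ (2 * r)) ℚ ^ 2 * ∏ j ∈ Finset.Icc 1 r, cyclotomic (n ^ (2 * j - 1)) ℚ ^ 2)
      (truncatedSum (RatFunc.X : RatFunc ℚ) (n ^ (2 * r) - 1))
      (closedForm (RatFunc.X : RatFunc ℚ) (n ^ (2 * r))) := by
  have hodd : Odd (n ^ (2 * r)) := (Nat.odd_iff.mpr (by omega)).pow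
  have h := isCyclotomicValuation_cyclotomicValuation hodd.pos
  have hfac : ∀ j ∈ Finset.Icc 1 r, n ^ (2 * j - 1) % 4 = 3 ∧
      ∃ s, n ^ (2 * r) = n ^ (2 * j - 1) * (2 * s + 1) := fun j hj => by
    have hj' := Finset.mem_Icc.mp hj
    refine ⟨?_, ?_⟩
    · have := pow_odd_mod_four hn (j - 1)
      rwa [show 2 * (j - 1) + 1 = 2 * j - 1 by omega] at this
    · obtain ⟨s, hs⟩ : Odd (n ^ (2 * (r - j) + 1)) := (Nat.odd_iff.mpr (by omega)).pow
      refine ⟨s, ?_⟩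
      rw [← hs, ← pow_add]
      congr 1
      omega
  refine ⟨ratCongr_of_cyclotomic_sq_dvd (by omega) ?_ fun j hj => ?_,
    ratCongr_of_cyclotomic_sq_dvd (by omega) ?_ fun j hj => ?_⟩
  -- Here `d = n^(2r) ≡ 1 (mod 4)`, so the single-block congruence is needed.
  · exact cyclotomic_sq_dvd_num _ (h.map_truncatedSum_half_sub_closedForm_le_self hodd)
  · obtain ⟨h₃, s, hs⟩ := hfac j hj
    rw [hs]
    exact cyclotomic_sq_dvd_num (by omega) ((isCyclotomicValuation_cyclotomicValuation
      (by omega)).map_truncatedSum_half_sub_closedForm_le h₃ s)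
  · exact cyclotomic_sq_dvd_num _ (h.map_truncatedSum_sub_closedForm_le_self hodd)
  · obtain ⟨h₃, s, hs⟩ := hfac j hj
    rw [hs]
    exact cyclotomic_sq_dvd_num (by omega) ((isCyclotomicValuation_cyclotomicValuation
      (by omega)).map_truncatedSum_sub_closedForm_le h₃ s)
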